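/- Let $(\mathcal X,\mu_X)$ and $(\mathcal Y,\mu_Y)$ be probability spaces, $\mu=\mu_X\otimes\mu_Y$, and let $(p_j)_{j\in\mathcal J}$, $(q_k)_{k\in\mathcal K}$ be orthonormal bases, consisting of measurable functions and indexed by countable sets, of $L^2(\mu_X)$ and $L^2(\mu_Y)$. Suppose that $p_{j_0}\equiv 1$ and $q_{k_0}\equiv 1$ for some $j_0\in\mathcal J$, $k_0\in\mathcal K$, and write $p_{jk}(x,y)=p_j(x)q_k(y)$. Let $\mathcal F$ be the set of probability densities $f\in L^2(\mu)$ with respect to $\mu$. For $f\in\mathcal F$ with marginal densities $f_X(x)=\int f(x,y)\,d\mu_Y(y)$ and $f_Y(y)=\int f(x,y)\,d\mu_X(x)$ put $$D(f)=\int (f(x,y)-f_X(x)f_Y(y))^2\,d\mu(x,y),\qquad S_\theta(f)=\sum_{j,k}\theta_{jk}^2\Bigl(\int f p_{jk}\,d\mu-\int f_Xp_j\,d\mu_X\int f_Yq_k\,d\mu_Y\Bigr)^2\in[0,\infty]$$ for an array $\theta\in[0,\infty)^{\mathcal J\times\mathcal K}$, and $\mathcal M_\theta(T)=\{(j,k):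 j\ne j_0,\ k\ne k_0,\ \theta_{jk}\le T\}$. A test based on $n$ observations is a measurable $\psi:(\mathcal X\times\mathcal Y)^n\to[0,1]$; $\mathbb E_P(\psi)$ and $\mathbb E_f(\psi)$ denote its expectation when the $n$ pairs are i.i.d. with law $P$, respectively with density $f$ with respect to $\mu$. $\Psi(\alpha)$ is the set of tests with $\mathbb E_P(\psi)\le\alpha$ for every law $P$ of a pair $(X,Y)$ with independent components. A permutation test of nominal level $\alpha$ is a test that, for some measurable real statistic $T$ and some integer $B\ge1$, assigns to the data $(x_i,y_i)_{i\le n}$ the probability that $$1+\#\{b\le B: T((x_i,y_i)_{i\le n})\le T((x_i,y_{\Pi_b(i)})_{i\le n})\}\le (1+B)\alpha,$$ where $\Pi_1,\dots,\Pi_B$ are independent uniformly random permutations of $\{1,\dots,n\}$. There is a constant $C(\alpha,\beta)>0$, depending only on $\alpha\in(0,1)$ and $\beta\in(0,1-\alpha)$, such that the following holds for all such spaces and bases. Let $n\ge1$, $\alpha\in[0,1]$, let $\psi$ be a test based on $n$ observations with $\mathbb E_\mu(\psi)\le\alpha$, let $\theta\in[0,\infty)^{\mathcal J\times\mathcal K}$,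 let $0<\rho\le 1/\sup_{j,k}\sup_{x,y}|p_{jk}(x,y)|$, and let $r\in\mathbb R$ be such that $\mathcal M_\theta(r/\rho)\ne\emptyset$ (which holds in particular if $r>\rho\,\inf_{j\ne j_0,k\ne k_0}\theta_{jk}$). (i) For every $\varepsilon>0$ there is $f^*\in\mathcal F$ with $D(f^*)=\rho^2$ and $S_\theta(f^*)\le r^2$ such that $$\mathbb E_{f^*}(\psi)\le\alpha+\varepsilon+\Bigl[\frac{\{(1+\rho^2)^n-1\}\alpha}{|\mathcal M_\theta(r/\rho)|}\Bigr]^{1/2}$$ (the last term being $0$ if $\mathcal M_\theta(r/\rho)$ is infinite), and moreover, if $\alpha>0$, there is a permutation test $\psi_{f^*}\in\Psi(\alpha)$ of nominal level $\alpha$, based on $n$ observations, such that for every $\beta\in(0,1-\alpha)$: if $n>C(\alpha,\beta)/\rho^2$, then $\mathbb E_{f^*}(\psi_{f^*})\ge1-\beta$. (ii) Consequently, if $\mathcal M_\theta(r/\rho)$ is infinite, there is no $\delta>0$ such that $\mathbb E_f(\psi)\ge\alpha+\delta$ for all $f\in\mathcal F$ with $S_\theta(f)\le r^2$ and $D(f)\ge\rho^2$.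 -/

import Mathlib

open MeasureTheory ProbabilityTheory
open scoped NNReal ENNReal

namespace IndepTest

/-- `p` is an orthonormal basis of `L²(μ)`, given by measurable functions: there is a Hilbert basis
of the space of classes whose members are represented by the functions `p j`. -/
structure IsL2Basis {Z J : Type*} [MeasurableSpace Z] (μ : Measure Z) (p : J → Z → ℝ) : Prop where
  measurable : ∀ j, Measurable (p j)
  exists_basis : ∃ b : HilbertBasis J ℝ (Lp ℝ 2 μ), ∀ j, (b j : Z → ℝ) =ᵐ[μ] p j

/-- The supremum norm `sup_z |g z|`, in `[0, ∞]`. -/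
noncomputable def supNorm {Z : Type*} (g : Z → ℝ) : ℝ≥0∞ := ⨆ z, ‖g z‖ₑ

section

variable {X Y J K : Type*}

/-- The tensor product basis function `p_{jk}(x, y) = p_j(x) q_k(y)`. -/
def tensor (p : J → X → ℝ) (q : K → Y → ℝ) (j : J) (k : K) : X × Y → ℝ :=
  fun z => p j z.1 * q k z.2

/-- The sample with the second components permuted by `σ`. -/
def permute {n : ℕ} (σ : Equiv.Perm (Fin n)) (z : Fin n → X × Y) : Fin n → X × Y :=
  fun i => ((z i).1, (z (σ i)).2)

/-- The Monte Carlo permutation test at level `α` with statistic `T` and `B` permutations: the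
probability, over independent uniformly random permutations `s 1, …, s B`, that the p-value
`(1 + #{b | T z ≤ T (permute (s b) z)}) / (1 + B)` is at most `α`. -/
noncomputable def permTest {n : ℕ} (α : ℝ) (T : (Fin n → X × Y) → ℝ) (B : ℕ)
    (z : Fin n → X × Y) : ℝ :=
  ((Finset.univ.filter fun s : Fin B → Equiv.Perm (Fin n) =>
      (1 : ℝ) + ((Finset.univ.filter fun b : Fin B => T z ≤ T (permute (s b) z)).card : ℝ)
        ≤ (1 + (B : ℝ)) * α).card : ℝ)
    / (Fintype.card (Fin B → Equiv.Perm (Fin n)) : ℝ)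

/-- The set `M_θ(T)` of pairs `(j, k)` with `j ≠ j₀`, `k ≠ k₀` and `θ_{jk} ≤ T`. -/
def freqSet (j₀ : J) (k₀ : K) (θ : J → K → ℝ≥0) (T : ℝ) : Set (J × K) :=
  {m | m.1 ≠ j₀ ∧ m.2 ≠ k₀ ∧ (θ m.1 m.2 : ℝ) ≤ T}

variable [MeasurableSpace X] [MeasurableSpace Y]

/-- `f` is a square integrable probability density with respect to `μX ⊗ μY`. -/
structure IsDensity (μX : Measure X) (μY : Measure Y) (f : X × Y → ℝ) : Prop where
  measurable : Measurable f
  memLp : MemLp f 2 (μX.prod μY)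
  nonneg : ∀ᵐ z ∂(μX.prod μY), 0 ≤ f z
  integral_eq_one : ∫ z, f z ∂(μX.prod μY) = 1

/-- The marginal density of the first component. -/
noncomputable def margX (μY : Measure Y) (f : X × Y → ℝ) (x : X) : ℝ := ∫ y, f (x, y) ∂μY

/-- The marginal density of the second component. -/
noncomputable def margY (μX : Measure X) (f : X × Y → ℝ) (y : Y) : ℝ := ∫ x, f (x, y) ∂μX

/-- The measure of dependence `D(f)`. -/
noncomputable def depD (μX : Measure X) (μY : Measure Y) (f : X × Y → ℝ) : ℝ :=
  ∫ z, (f z - margX μY f z.1 * margY μX f z.2) ^ 2 ∂(μX.prod μY)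

/-- The coefficient `a_{jk}(f)`. -/
noncomputable def coeff (μX : Measure X) (μY : Measure Y) (p : J → X → ℝ) (q : K → Y → ℝ)
    (f : X × Y → ℝ) (j : J) (k : K) : ℝ :=
  ∫ z, f z * tensor p q j k z ∂(μX.prod μY)

/-- The coefficient `a_{j•}(f)` of the first marginal density. -/
noncomputable def coeffX (μX : Measure X) (μY : Measure Y) (p : J → X → ℝ)
    (f : X × Y → ℝ) (j : J) : ℝ :=
  ∫ x, margX μY f x * p j x ∂μX

/-- The coefficient `a_{•k}(f)` of the second marginal density. -/
noncomputable def coeffY (μX : Measure X) (μY : Measure Y) (q : K → Y → ℝ)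
    (f : X × Y → ℝ) (k : K) : ℝ :=
  ∫ y, margY μX f y * q k y ∂μY

/-- The smoothness functional `S_θ(f)`, in `[0, ∞]`. -/
noncomputable def smoothS (μX : Measure X) (μY : Measure Y) (p : J → X → ℝ) (q : K → Y → ℝ)
    (θ : J → K → ℝ≥0) (f : X × Y → ℝ) : ℝ≥0∞ :=
  ∑' j, ∑' k, (θ j k : ℝ≥0∞) ^ 2 *
    ENNReal.ofReal ((coeff μX μY p q f j k - coeffX μX μY p f j * coeffY μX μY q f k) ^ 2)

/-- A randomised test based on `n` pairs: a measurable function into `[0, 1]`. -/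
structure IsTest {n : ℕ} (ψ : (Fin n → X × Y) → ℝ) : Prop where
  measurable : Measurable ψ
  mem_Icc : ∀ z, ψ z ∈ Set.Icc (0 : ℝ) 1

/-- The expectation `E_P(ψ)` when the `n` pairs are independent with distribution `P`. -/
noncomputable def expect {n : ℕ} (P : Measure (X × Y)) (ψ : (Fin n → X × Y) → ℝ) : ℝ :=
  ∫ z, ψ z ∂(Measure.pi fun _ : Fin n => P)

/-- The expectation `E_f(ψ)` when the `n` pairs are independent with density `f`. -/
noncomputable def expectD {n : ℕ} (μX : Measure X) (μY : Measure Y) (f : X × Y → ℝ)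
    (ψ : (Fin n → X × Y) → ℝ) : ℝ :=
  expect ((μX.prod μY).withDensity fun z => ENNReal.ofReal (f z)) ψ

/-- `ψ` belongs to `Ψ(α)`: it is a test with `E_P(ψ) ≤ α` for every distribution `P` of a pair with
independent components. -/
structure IsValidTest {n : ℕ} (α : ℝ) (ψ : (Fin n → X × Y) → ℝ) : Prop where
  isTest : IsTest ψ
  level : ∀ P : Measure (X × Y), IsProbabilityMeasure P →
    IndepFun (Prod.fst : X × Y → X) (Prod.snd : X × Y → Y) P → expect P ψ ≤ α

/-- `ψ` is a permutation test of nominal level `α`, based on some measurable statistic and some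
number `B ≥ 1` of random permutations. -/
def IsPermutationTest {n : ℕ} (α : ℝ) (ψ : (Fin n → X × Y) → ℝ) : Prop :=
  ∃ T : (Fin n → X × Y) → ℝ, Measurable T ∧ ∃ B : ℕ, 1 ≤ B ∧ ψ = permTest α T B

end

end IndepTest

open IndepTest

/-! The alternatives are the perturbations `1 + ρ p_j(x) q_k(y)` with `(j, k)` in `freqSet`. The
bound on `ρ` makes them nonnegative, both marginals are uniform, and the only nonzero dependence
coefficient is `ρ`, at `(j, k)`. Hence `D = ρ²` and `S_θ = θ_{jk}² ρ² ≤ r²`.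

No test detects all of them. Under `μ^n`, the centred likelihood ratios `L_m - 1` of different
perturbations are orthogonal, each with variance `V = (1 + ρ²)^n - 1`. Cauchy-Schwarz for `ψ`
against their sum over a finite index set `S` bounds the average power by `α + √(V α / |S|)`, so
some member of `S` has power at most this (`exists_integral_mul_prod_le`). If `freqSet` is infinite,
`S` can be taken so large that the root is below any `ε`.

For a known pair `(j, k)` detection is easy. The statistic `∑ p_j(x_i) q_k(y_i)` has mean `n ρ` and
variance at most `2 n`, while after a random permutation its second moment is still of order `n`.
Chebyshev's inequality and Markov's inequality for the p-value then give power once `n ρ²` exceeds a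
constant (`le_expectD_permTest`). The level over all independent laws comes from exchangeability of
the permuted samples (`isValidTest_permTest`). -/

namespace IndepTest

/-! ### Ranks and the level of permutation tests -/

/-- At most `κ` of the finitely many values `t c` have upper rank at most `κ`. -/
lemma card_filter_rank_le {ι : Type*} [Fintype ι] (t : ι → ℝ) {κ : ℝ} (hκ : 0 ≤ κ) :
    ((Finset.univ.filter fun c =>
      ((Finset.univ.filter fun b => t c ≤ t b).card : ℝ) ≤ κ).card : ℝ) ≤ κ := by
  set S := Finset.univ.filter fun c =>
      ((Finset.univ.filter fun b => t c ≤ t b).card : ℝ) ≤ κ with hS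
  rcases S.eq_empty_or_nonempty with h | h
  · simpa [h] using hκ
  -- The smallest value in `S` is dominated by every member of `S`, so its upper rank is at least
  -- the size of `S`.
  · obtain ⟨c, hc, hmin⟩ := S.exists_min_image t h
    have hsub : S ⊆ Finset.univ.filter fun b => t c ≤ t b := fun b hb => by
      simpa using hmin b hb
    exact (Nat.cast_le.mpr (Finset.card_le_card hsub)).trans (by simpa [hS] using hc)

/-- The upper rank of the value at a fixed index, averaged over all families, is at most `κ` with
frequency at most `κ / card ι`. -/
lemma sum_rank_le {ι G : Type*} [Fintype ι] [DecidableEq ι] [Fintype G] (t : G → ℝ) {κ : ℝ}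
    (hκ : 0 ≤ κ) (c₀ : ι) :
    (Fintype.card ι : ℝ) * ∑ u : ι → G,
      (if ((Finset.univ.filter fun b => t (u c₀) ≤ t (u b)).card : ℝ) ≤ κ then (1 : ℝ) else 0)
      ≤ Fintype.card (ι → G) * κ := by
  -- Exchangeability: swapping the coordinates `c₀` and `c` of the family permutes the summands, so
  -- averaging over `c` reduces to a count within one family.
  have hsymm : ∀ c : ι, ∑ u : ι → G,
      (if ((Finset.univ.filter fun b => t (u c₀) ≤ t (u b)).card : ℝ) ≤ κ then (1 : ℝ) else 0)
      = ∑ u : ι → G,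
      (if ((Finset.univ.filter fun b => t (u c) ≤ t (u b)).card : ℝ) ≤ κ then (1 : ℝ) else 0) := by
    intro c
    refine Fintype.sum_equiv ((Equiv.swap c₀ c).arrowCongr (Equiv.refl G)) _ _ fun u => ?_
    have : (Finset.univ.filter fun b => t (u c₀) ≤ t (u b)).card
        = (Finset.univ.filter fun b => t (((Equiv.swap c₀ c).arrowCongr (Equiv.refl G)) u c)
          ≤ t (((Equiv.swap c₀ c).arrowCongr (Equiv.refl G)) u b)).card := by
      refine Finset.card_equiv (Equiv.swap c₀ c) fun b => ?_
      simp
    rw [this]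
  have h1 : (Fintype.card ι : ℝ) * ∑ u : ι → G,
      (if ((Finset.univ.filter fun b => t (u c₀) ≤ t (u b)).card : ℝ) ≤ κ then (1 : ℝ) else 0)
      = ∑ u : ι → G, ∑ c : ι,
      (if ((Finset.univ.filter fun b => t (u c) ≤ t (u b)).card : ℝ) ≤ κ then (1 : ℝ) else 0) := by
    rw [Finset.sum_comm, ← Finset.sum_congr rfl (fun c _ => hsymm c)]
    simp
  rw [h1]
  calc _ ≤ ∑ u : ι → G, κ := Finset.sum_le_sum fun u _ => by
        rw [Finset.sum_boole]
        exact card_filter_rank_le (fun c => t (u c)) hκ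
    _ = _ := by rw [Finset.sum_const, nsmul_eq_mul, Finset.card_univ]

section

variable {X Y : Type*}

lemma permute_permute {n : ℕ} (σ τ : Equiv.Perm (Fin n)) (z : Fin n → X × Y) :
    permute τ (permute σ z) = permute (σ * τ) z := rfl

lemma permTest_eq_sum {n : ℕ} (α : ℝ) (T : (Fin n → X × Y) → ℝ) (B : ℕ) (z : Fin n → X × Y) :
    permTest α T B z = (∑ s : Fin B → Equiv.Perm (Fin n),
      if (1 : ℝ) + ((Finset.univ.filter fun b : Fin B => T z ≤ T (permute (s b) z)).card : ℝ)
        ≤ (1 + (B : ℝ)) * α then (1 : ℝ) else 0)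
      / (Fintype.card (Fin B → Equiv.Perm (Fin n)) : ℝ) := by
  rw [permTest, Finset.sum_boole]

lemma permTest_mem_Icc {n : ℕ} (α : ℝ) (T : (Fin n → X × Y) → ℝ) (B : ℕ) (z : Fin n → X × Y) :
    permTest α T B z ∈ Set.Icc (0 : ℝ) 1 := by
  rw [permTest]
  refine ⟨by positivity, div_le_one_of_le₀ ?_ (by positivity)⟩
  exact_mod_cast Finset.card_le_univ _

/-- Averaged over the orbit of the data under permutations, the permutation test is at most `α`. -/
lemma sum_permTest_permute_le {n : ℕ} {α : ℝ} (hα : 0 ≤ α) (T : (Fin n → X × Y) → ℝ) (B : ℕ)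
    (z : Fin n → X × Y) :
    ∑ g : Equiv.Perm (Fin n), permTest α T B (permute g z)
      ≤ Fintype.card (Equiv.Perm (Fin n)) * α := by
  -- The index `none` stands for the observed sample and `some b` for its `b`-th permutation, giving
  -- `1 + B` competitors.
  have key := sum_rank_le (ι := Option (Fin B))  (fun g => T (permute g z))
    (κ := (1 + (B : ℝ)) * α) (by positivity) none
  have h1 : ∑ g : Equiv.Perm (Fin n), permTest α T B (permute g z) = (∑ u : Option (Fin B) → Equiv.Perm (Fin n),
      (if ((Finset.univ.filter fun b => T (permute (u none) z) ≤ T (permute (u b) z)).card : ℝ)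
        ≤ (1 + (B : ℝ)) * α then (1 : ℝ) else 0)) / Fintype.card (Fin B → Equiv.Perm (Fin n)) := by
    simp_rw [permTest_eq_sum, ← Finset.sum_div]
    congr 1
    rw [← Fintype.sum_prod_type' (f := fun (g : Equiv.Perm (Fin n)) (s : Fin B → Equiv.Perm (Fin n)) => if (1 : ℝ) +
      ((Finset.univ.filter fun b : Fin B => T (permute g z) ≤ T (permute (s b) (permute g z))).card
        : ℝ) ≤ (1 + (B : ℝ)) * α then (1 : ℝ) else 0)]
    -- Since `g` and the `g * s b` range freely over all families of `1 + B` permutations, the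
    -- permuted samples are on an equal footing with the observed one.
    let e : Equiv.Perm (Fin n) × (Fin B → Equiv.Perm (Fin n)) ≃ (Option (Fin B) → Equiv.Perm (Fin n)) :=
      { toFun := fun w b => b.elim w.1 fun b => w.1 * w.2 b
        invFun := fun u => (u none, fun b => (u none)⁻¹ * u (some b))
        left_inv := fun w => by ext1 <;> simp
        right_inv := fun u => by ext1 b; cases b <;> simp }
    refine Fintype.sum_equiv e _ _ fun w => ?_
    -- The `1` added in the p-value is the comparison of the observed sample with itself.
    have : (1 : ℝ) + ((Finset.univ.filter fun b : Fin B =>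
          T (permute w.1 z) ≤ T (permute (w.2 b) (permute w.1 z))).card : ℝ)
        = ((Finset.univ.filter fun b => T (permute (e w none) z) ≤ T (permute (e w b) z)).card
          : ℝ) := by
      rw [Finset.card_filter, Finset.card_filter, Fintype.sum_option]
      simp only [e, permute_permute, Equiv.coe_fn_mk, Option.elim_none, Option.elim_some, le_refl, if_true]
      push_cast
      rfl
    rw [this]
  rw [h1, div_le_iff₀ (by positivity)]
  have hc : (Fintype.card (Option (Fin B) → Equiv.Perm (Fin n)) : ℝ)
      = Fintype.card (Equiv.Perm (Fin n)) * Fintype.card (Fin B → Equiv.Perm (Fin n)) := by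
    simp [pow_succ, mul_comm]
  rw [hc, Fintype.card_option, Fintype.card_fin] at key
  push_cast at key
  have hB : (0 : ℝ) < 1 + B := by positivity
  refine le_of_mul_le_mul_left ?_ hB
  calc _ = ((B : ℝ) + 1) * _ := by rw [add_comm]
    _ ≤ _ := key
    _ = _ := by ring

variable [MeasurableSpace X] [MeasurableSpace Y]

lemma measurable_permute {n : ℕ} (σ : Equiv.Perm (Fin n)) :
    Measurable (permute σ : (Fin n → X × Y) → Fin n → X × Y) := by
  unfold permute; fun_prop

lemma measurable_permTest {n : ℕ} (α : ℝ) {T : (Fin n → X × Y) → ℝ} (hT : Measurable T) (B : ℕ) :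
    Measurable (permTest α T B) := by
  have : permTest α T B = fun z => permTest α T B z := rfl
  rw [this]
  simp_rw [permTest_eq_sum, Finset.card_filter]
  push_cast
  refine Measurable.div_const (Finset.measurable_fun_sum _ fun s _ => ?_) _
  refine Measurable.ite (measurableSet_le (measurable_const.add
    (Finset.measurable_fun_sum _ fun b _ => ?_)) measurable_const) measurable_const measurable_const
  exact Measurable.ite (measurableSet_le hT (hT.comp (measurable_permute _)))
    measurable_const measurable_const

lemma isTest_permTest {n : ℕ} (α : ℝ) {T : (Fin n → X × Y) → ℝ} (hT : Measurable T) (B : ℕ) :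
    IsTest (permTest α T B) :=
  ⟨measurable_permTest α hT B, permTest_mem_Icc α T B⟩

/-- Permuting the second components preserves the law of an independent sample from a product. -/
lemma measurePreserving_permute {n : ℕ} (μ : Measure X) (ν : Measure Y) [SigmaFinite μ]
    [SigmaFinite ν] (σ : Equiv.Perm (Fin n)) :
    MeasurePreserving (permute σ) (Measure.pi fun _ : Fin n => μ.prod ν)
      (Measure.pi fun _ : Fin n => μ.prod ν) := by
  -- Splitting the sample into its two coordinate vectors turns the permutation into a reindexing of
  -- the second, i.i.d. vector.
  have h1 := measurePreserving_arrowProdEquivProdArrow X Y (Fin n) (fun _ => μ) (fun _ => ν)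
  have h2 := measurePreserving_piCongrLeft (fun _ : Fin n => ν) σ⁻¹
  have h3 := (h1.symm _).comp (((MeasurePreserving.id _).prod h2).comp h1)
  convert h3 using 1
  ext z i
  · rfl
  · have : (MeasurableEquiv.piCongrLeft (fun _ : Fin n => Y) σ⁻¹)
        (fun i => (z i).2) i = (z (σ i)).2 := by
      have := MeasurableEquiv.piCongrLeft_apply_apply (β := fun _ : Fin n => Y) σ⁻¹
        (fun i => (z i).2) (σ i)
      simpa using this
    exact this.symm

lemma IsTest.integrable {n : ℕ} {ψ : (Fin n → X × Y) → ℝ} (h : IsTest ψ)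
    (P : Measure (Fin n → X × Y)) [IsFiniteMeasure P] : Integrable ψ P :=
  Integrable.of_bound h.measurable.aestronglyMeasurable 1 <| ae_of_all _ fun z => by
    rw [Real.norm_eq_abs, abs_le]; exact ⟨by linarith [(h.mem_Icc z).1], (h.mem_Icc z).2⟩

/-- Permutation tests have level `α` over all laws with independent components. -/
lemma isValidTest_permTest {n : ℕ} {α : ℝ} (hα : 0 ≤ α) {T : (Fin n → X × Y) → ℝ}
    (hT : Measurable T) (B : ℕ) : IsValidTest α (permTest α T B) := by
  refine ⟨isTest_permTest α hT B, fun P _ hP => ?_⟩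
  have hprod : P = (P.map Prod.fst).prod (P.map Prod.snd) := by
    have := (indepFun_iff_map_prod_eq_prod_map_map measurable_fst.aemeasurable
      measurable_snd.aemeasurable).mp hP
    simpa using this
  have : IsProbabilityMeasure (P.map Prod.fst) :=
    Measure.isProbabilityMeasure_map measurable_fst.aemeasurable
  have : IsProbabilityMeasure (P.map Prod.snd) :=
    Measure.isProbabilityMeasure_map measurable_snd.aemeasurable
  set Q := Measure.pi fun _ : Fin n => P with hQ
  have hinv : ∀ g : Equiv.Perm (Fin n), MeasurePreserving (permute g) Q Q := fun g => by
    rw [hQ, hprod]; exact measurePreserving_permute _ _ g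
  have hint : ∀ g : Equiv.Perm (Fin n), ∫ z, permTest α T B (permute g z) ∂Q
      = expect P (permTest α T B) := fun g => by
    conv_rhs => rw [expect, ← hQ, ← (hinv g).map_eq]
    exact (integral_map (hinv g).measurable.aemeasurable
      (measurable_permTest α hT B).aestronglyMeasurable).symm
  have hI : ∀ g : Equiv.Perm (Fin n), Integrable (fun z => permTest α T B (permute g z)) Q :=
    fun g => (hinv g).integrable_comp_of_integrable ((isTest_permTest α hT B).integrable Q)
  have hsum : (Fintype.card (Equiv.Perm (Fin n)) : ℝ) * expect P (permTest α T B)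
      ≤ Fintype.card (Equiv.Perm (Fin n)) * α := by
    calc _ = ∑ g : Equiv.Perm (Fin n), ∫ z, permTest α T B (permute g z) ∂Q := by simp [hint]
      _ = ∫ z, ∑ g : Equiv.Perm (Fin n), permTest α T B (permute g z) ∂Q :=
        (integral_finsetSum _ fun g _ => hI g).symm
      _ ≤ ∫ z, Fintype.card (Equiv.Perm (Fin n)) * α ∂Q :=
        integral_mono (integrable_finsetSum _ fun g _ => hI g) (integrable_const _)
          fun z => sum_permTest_permute_le hα T B z
      _ = _ := by simp
  exact le_of_mul_le_mul_left hsum (by exact_mod_cast Fintype.card_pos)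

end

/-! ### Bounded functions and product densities -/

/-- Bounded measurable real functions. -/
structure IsBddMeas {Z : Type*} [MeasurableSpace Z] (g : Z → ℝ) : Prop where
  measurable : Measurable g
  bounded : ∃ C, ∀ z, |g z| ≤ C

namespace IsBddMeas

variable {Z W : Type*} [MeasurableSpace Z] [MeasurableSpace W] {g h : Z → ℝ}

lemma integrable (hg : IsBddMeas g) (μ : Measure Z) [IsFiniteMeasure μ] : Integrable g μ := by
  obtain ⟨C, hC⟩ := hg.bounded
  exact Integrable.of_bound hg.measurable.aestronglyMeasurable C (ae_of_all _ hC)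

lemma memLp_two (hg : IsBddMeas g) (μ : Measure Z) [IsFiniteMeasure μ] : MemLp g 2 μ := by
  obtain ⟨C, hC⟩ := hg.bounded
  exact MemLp.of_bound hg.measurable.aestronglyMeasurable C (ae_of_all _ hC)

lemma const (c : ℝ) : IsBddMeas fun _ : Z => c := ⟨measurable_const, |c|, fun _ => le_rfl⟩

lemma mul (hg : IsBddMeas g) (hh : IsBddMeas h) : IsBddMeas fun z => g z * h z := by
  obtain ⟨C, hC⟩ := hg.bounded
  obtain ⟨D, hD⟩ := hh.bounded
  refine ⟨hg.measurable.mul hh.measurable, C * D, fun z => ?_⟩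
  rw [abs_mul]
  exact mul_le_mul (hC z) (hD z) (abs_nonneg _) ((abs_nonneg _).trans (hC z))

lemma add (hg : IsBddMeas g) (hh : IsBddMeas h) : IsBddMeas fun z => g z + h z := by
  obtain ⟨C, hC⟩ := hg.bounded
  obtain ⟨D, hD⟩ := hh.bounded
  exact ⟨hg.measurable.add hh.measurable, C + D,
    fun z => (abs_add_le _ _).trans (add_le_add (hC z) (hD z))⟩

lemma sq (hg : IsBddMeas g) : IsBddMeas fun z => g z ^ 2 := by
  simp_rw [pow_two]; exact hg.mul hg

lemma comp (hg : IsBddMeas g) {u : W → Z} (hu : Measurable u) : IsBddMeas fun w => g (u w) := by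
  obtain ⟨C, hC⟩ := hg.bounded
  exact ⟨hg.measurable.comp hu, C, fun w => hC _⟩

lemma sum {ι : Type*} (s : Finset ι) {G : ι → Z → ℝ} (hG : ∀ i, IsBddMeas (G i)) :
    IsBddMeas fun z => ∑ i ∈ s, G i z := by
  choose C hC using fun i => (hG i).bounded
  exact ⟨Finset.measurable_fun_sum _ fun i _ => (hG i).measurable, ∑ i ∈ s, C i, fun z =>
    (Finset.abs_sum_le_sum_abs _ _).trans (Finset.sum_le_sum fun i _ => hC i z)⟩

lemma prod {ι : Type*} (s : Finset ι) {G : ι → Z → ℝ} (hG : ∀ i, IsBddMeas (G i)) :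
    IsBddMeas fun z => ∏ i ∈ s, G i z := by
  choose C hC using fun i => (hG i).bounded
  exact ⟨Finset.measurable_fun_prod _ fun i _ => (hG i).measurable, ∏ i ∈ s, C i, fun z => by
    rw [Finset.abs_prod]
    exact Finset.prod_le_prod (fun i _ => abs_nonneg _) (fun i _ => hC i z)⟩

end IsBddMeas

/-- A product of measures with densities has the product density. -/
lemma pi_withDensity {Z ι : Type*} [MeasurableSpace Z] [Fintype ι] (μ : Measure Z)
    [IsProbabilityMeasure μ] {f : Z → ℝ} (hf : IsBddMeas f) (h0 : ∀ z, 0 ≤ f z) :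
    Measure.pi (fun _ : ι => μ.withDensity fun z => ENNReal.ofReal (f z))
      = (Measure.pi fun _ : ι => μ).withDensity fun z => ENNReal.ofReal (∏ i, f (z i)) := by
  have : IsFiniteMeasure (μ.withDensity fun z => ENNReal.ofReal (f z)) :=
    isFiniteMeasure_withDensity_ofReal (hf.integrable μ).2
  refine Measure.pi_eq fun s hs => ?_
  rw [withDensity_apply _ (MeasurableSet.univ_pi hs), Measure.restrict_pi_pi,
    ← ofReal_integral_eq_lintegral_ofReal
      ((IsBddMeas.prod _ fun i => hf.comp (measurable_pi_apply i)).integrable _)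
      (ae_of_all _ fun z => Finset.prod_nonneg fun i _ => h0 _),
    integral_fintype_prod_eq_prod (μ := fun i => μ.restrict (s i)) (fun _ => f),
    ENNReal.ofReal_prod_of_nonneg fun i _ => integral_nonneg h0]
  refine Finset.prod_congr rfl fun i _ => ?_
  rw [withDensity_apply _ (hs i), ofReal_integral_eq_lintegral_ofReal (hf.integrable _)
    (ae_of_all _ h0)]

lemma integral_withDensity_ofReal {Z : Type*} [MeasurableSpace Z] (μ : Measure Z)
    {f : Z → ℝ} (hf : Measurable f) (h0 : ∀ z, 0 ≤ f z) (g : Z → ℝ) :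
    ∫ z, g z ∂(μ.withDensity fun z => ENNReal.ofReal (f z)) = ∫ z, g z * f z ∂μ := by
  rw [integral_withDensity_eq_integral_toReal_smul hf.ennreal_ofReal
    (ae_of_all _ fun z => ENNReal.ofReal_lt_top)]
  simp [h0, mul_comm]

lemma prod_ite_or {ι M : Type*} [Fintype ι] [DecidableEq ι] [CommMonoid M] {i l : ι} (h : i ≠ l)
    (F : ι → M) : ∏ m, (if m = i ∨ m = l then F m else 1) = F i * F l := by
  rw [← Finset.prod_filter]
  have : Finset.univ.filter (fun m => m = i ∨ m = l) = {i, l} := by ext; simp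
  rw [this, Finset.prod_pair h]

/-! ### Moments of the bilinear statistic under a perturbation -/

section

variable {X Y : Type*} [MeasurableSpace X] [MeasurableSpace Y]

lemma expectD_eq_integral_mul_prod {n : ℕ} (μX : Measure X) (μY : Measure Y)
    [IsProbabilityMeasure μX] [IsProbabilityMeasure μY] {f : X × Y → ℝ} (hf : IsBddMeas f)
    (h0 : ∀ z, 0 ≤ f z) (ψ : (Fin n → X × Y) → ℝ) :
    expectD μX μY f ψ
      = ∫ z, ψ z * ∏ i, f (z i) ∂(Measure.pi fun _ : Fin n => μX.prod μY) := by
  rw [expectD, expect, pi_withDensity _ hf h0, integral_withDensity_ofReal _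
    (IsBddMeas.prod _ fun i => hf.comp (measurable_pi_apply i)).measurable
    fun z => Finset.prod_nonneg fun i _ => h0 _]

/-- The perturbation `1 + ρ a(x) b(y)` of the uniform density. -/
def perturb (ρ : ℝ) (a : X → ℝ) (b : Y → ℝ) (z : X × Y) : ℝ := 1 + ρ * (a z.1 * b z.2)

/-- Bounded centred functions of unit norm whose perturbation is nonnegative. -/
structure IsPerturbation (μX : Measure X) (μY : Measure Y) (ρ : ℝ) (a : X → ℝ) (b : Y → ℝ) :
    Prop where
  bddX : IsBddMeas a
  bddY : IsBddMeas b
  meanX : ∫ x, a x ∂μX = 0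
  meanY : ∫ y, b y ∂μY = 0
  normX : ∫ x, a x ^ 2 ∂μX = 1
  normY : ∫ y, b y ^ 2 ∂μY = 1
  pos : 0 < ρ
  le_one : ρ ≤ 1
  abs_le : ∀ x y, |ρ * (a x * b y)| ≤ 1

/-- The law with density `perturb ρ a b`. -/
noncomputable def perturbLaw (μX : Measure X) (μY : Measure Y) (ρ : ℝ) (a : X → ℝ) (b : Y → ℝ) :
    Measure (X × Y) :=
  (μX.prod μY).withDensity fun z => ENNReal.ofReal (perturb ρ a b z)

/-- The statistic `∑ a(x_i) b(y_i)`. -/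
def bilinStat {n : ℕ} (a : X → ℝ) (b : Y → ℝ) (z : Fin n → X × Y) : ℝ :=
  ∑ i, a (z i).1 * b (z i).2

namespace IsPerturbation

variable {μX : Measure X} {μY : Measure Y} {ρ : ℝ} {a : X → ℝ} {b : Y → ℝ}

lemma bdd_mul (h : IsPerturbation μX μY ρ a b) : IsBddMeas fun z : X × Y => a z.1 * b z.2 :=
  (h.bddX.comp measurable_fst).mul (h.bddY.comp measurable_snd)

lemma bdd_perturb (h : IsPerturbation μX μY ρ a b) : IsBddMeas (perturb ρ a b) :=
  (IsBddMeas.const 1).add ((IsBddMeas.const ρ).mul h.bdd_mul)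

lemma perturb_nonneg (h : IsPerturbation μX μY ρ a b) (z : X × Y) : 0 ≤ perturb ρ a b z := by
  have := (_root_.abs_le.mp (h.abs_le z.1 z.2)).1
  unfold perturb; linarith

lemma perturb_le_two (h : IsPerturbation μX μY ρ a b) (z : X × Y) : perturb ρ a b z ≤ 2 := by
  have := (_root_.abs_le.mp (h.abs_le z.1 z.2)).2
  unfold perturb; linarith

lemma bdd_term (h : IsPerturbation μX μY ρ a b) {n : ℕ} (i l : Fin n) :
    IsBddMeas fun z : Fin n → X × Y => a (z i).1 * b (z l).2 :=
  (h.bddX.comp (measurable_fst.comp (measurable_pi_apply i))).mul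
    (h.bddY.comp (measurable_snd.comp (measurable_pi_apply l)))

lemma bdd_bilinStat (h : IsPerturbation μX μY ρ a b) {n : ℕ} (π : Equiv.Perm (Fin n)) :
    IsBddMeas fun z : Fin n → X × Y => bilinStat a b (permute π z) :=
  IsBddMeas.sum _ fun i => h.bdd_term i (π i)

lemma integral_perturbLaw (h : IsPerturbation μX μY ρ a b) (g : X × Y → ℝ) :
    ∫ z, g z ∂(perturbLaw μX μY ρ a b) = ∫ z, g z * perturb ρ a b z ∂(μX.prod μY) :=
  integral_withDensity_ofReal _ h.bdd_perturb.measurable h.perturb_nonneg g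

variable [IsProbabilityMeasure μX] [IsProbabilityMeasure μY]

/-- Both summands of the density factorise, so Fubini splits each integral. All later moments and
coefficients are read off from this identity. -/
lemma integral_mul_perturb (h : IsPerturbation μX μY ρ a b) {u : X → ℝ} {v : Y → ℝ}
    (hu : IsBddMeas u) (hv : IsBddMeas v) :
    ∫ z, u z.1 * v z.2 * perturb ρ a b z ∂(μX.prod μY)
      = (∫ x, u x ∂μX) * (∫ y, v y ∂μY) + ρ * ((∫ x, u x * a x ∂μX) * ∫ y, v y * b y ∂μY) := by
  have huv : IsBddMeas fun z : X × Y => u z.1 * v z.2 :=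
    (hu.comp measurable_fst).mul (hv.comp measurable_snd)
  have hab : IsBddMeas fun z : X × Y => (u z.1 * a z.1) * (v z.2 * b z.2) :=
    ((hu.mul h.bddX).comp measurable_fst).mul ((hv.mul h.bddY).comp measurable_snd)
  rw [← integral_prod_mul, ← integral_prod_mul (fun x => u x * a x) (fun y => v y * b y),
    ← integral_const_mul, ← integral_add (huv.integrable _) ((hab.integrable _).const_mul ρ)]
  refine integral_congr_ae (ae_of_all _ fun z => ?_)
  simp only [perturb]; ring

lemma integral_law_mul (h : IsPerturbation μX μY ρ a b) {u : X → ℝ} {v : Y → ℝ}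
    (hu : IsBddMeas u) (hv : IsBddMeas v) :
    ∫ z, u z.1 * v z.2 ∂(perturbLaw μX μY ρ a b)
      = (∫ x, u x ∂μX) * (∫ y, v y ∂μY) + ρ * ((∫ x, u x * a x ∂μX) * ∫ y, v y * b y ∂μY) := by
  rw [h.integral_perturbLaw, h.integral_mul_perturb hu hv]

lemma integral_perturb (h : IsPerturbation μX μY ρ a b) :
    ∫ z, perturb ρ a b z ∂(μX.prod μY) = 1 := by
  have := h.integral_mul_perturb (IsBddMeas.const 1) (IsBddMeas.const 1)
  simpa [h.meanX, h.meanY] using this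

lemma isProbabilityMeasure (h : IsPerturbation μX μY ρ a b) :
    IsProbabilityMeasure (perturbLaw μX μY ρ a b) := by
  refine ⟨?_⟩
  rw [perturbLaw, withDensity_apply _ MeasurableSet.univ, Measure.restrict_univ,
    ← ofReal_integral_eq_lintegral_ofReal (h.bdd_perturb.integrable _)
      (ae_of_all _ h.perturb_nonneg), h.integral_perturb, ENNReal.ofReal_one]

/-- The mixed moment of order at most one in each component. -/
lemma integral_law_ite (h : IsPerturbation μX μY ρ a b) (P Q : Prop) [Decidable P] [Decidable Q] :
    ∫ z, (if P then a z.1 else 1) * (if Q then b z.2 else 1) ∂(perturbLaw μX μY ρ a b)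
      = if P then (if Q then ρ else 0) else (if Q then 0 else 1) := by
  have h1 : IsBddMeas fun x => if P then a x else 1 := by
    split_ifs
    exacts [h.bddX, IsBddMeas.const 1]
  have h2 : IsBddMeas fun y => if Q then b y else 1 := by
    split_ifs
    exacts [h.bddY, IsBddMeas.const 1]
  rw [h.integral_law_mul h1 h2]
  have hX := h.normX
  have hY := h.normY
  simp_rw [pow_two] at hX hY
  split_ifs <;> simp [h.meanX, h.meanY, hX, hY]

lemma integral_law_sq_mul_sq_le (h : IsPerturbation μX μY ρ a b) :
    ∫ z, a z.1 ^ 2 * b z.2 ^ 2 ∂(perturbLaw μX μY ρ a b) ≤ 2 := by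
  have hb : IsBddMeas fun z : X × Y => a z.1 ^ 2 * b z.2 ^ 2 :=
    (h.bddX.sq.comp measurable_fst).mul (h.bddY.sq.comp measurable_snd)
  rw [h.integral_perturbLaw]
  calc _ ≤ ∫ z : X × Y, a z.1 ^ 2 * b z.2 ^ 2 * 2 ∂(μX.prod μY) :=
        integral_mono ((hb.mul h.bdd_perturb).integrable _)
          ((hb.mul (IsBddMeas.const 2)).integrable _)
          fun z => mul_le_mul_of_nonneg_left (h.perturb_le_two z) (by positivity)
    _ = 2 := by
        rw [integral_mul_const, integral_prod_mul (fun x => a x ^ 2) (fun y => b y ^ 2), h.normX,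
          h.normY]; norm_num

lemma integral_law_sq_le (h : IsPerturbation μX μY ρ a b) (P : Prop) [Decidable P] :
    ∫ z, a z.1 ^ 2 * (if P then b z.2 ^ 2 else 1) ∂(perturbLaw μX μY ρ a b) ≤ 2 := by
  split_ifs
  · exact h.integral_law_sq_mul_sq_le
  · rw [h.integral_law_mul h.bddX.sq (IsBddMeas.const 1)]
    simp [h.normX, h.meanY]

lemma integral_law_snd (h : IsPerturbation μX μY ρ a b) (P : Prop) [Decidable P] :
    ∫ z, (if P then b z.2 ^ 2 else 1) ∂(perturbLaw μX μY ρ a b) = 1 := by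
  have h2 : IsBddMeas fun y => if P then b y ^ 2 else 1 := by
    split_ifs
    exacts [h.bddY.sq, IsBddMeas.const 1]
  have := h.integral_law_mul (IsBddMeas.const 1) h2
  simp only [one_mul, h.meanX, zero_mul, mul_zero, add_zero] at this
  rw [this]
  split_ifs <;> simp [h.normY]

variable {n : ℕ}

/-- For `i = k` the density is at most 2; for `i ≠ k` independence and uniform marginals separate
the two unit norms. -/
lemma integral_pi_diag_le (h : IsPerturbation μX μY ρ a b) (i k : Fin n) :
    ∫ z, (a (z i).1 * b (z k).2) * (a (z i).1 * b (z k).2)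
      ∂(Measure.pi fun _ : Fin n => perturbLaw μX μY ρ a b) ≤ 2 := by
  have := h.isProbabilityMeasure
  let g : Fin n → X × Y → ℝ := fun m z =>
    (if m = i then a z.1 ^ 2 else 1) * (if m = k then b z.2 ^ 2 else 1)
  have h1 : ∀ z : Fin n → X × Y,
      (a (z i).1 * b (z k).2) * (a (z i).1 * b (z k).2) = ∏ m, g m (z m) := fun z => by
    simp only [g, Finset.prod_mul_distrib, Finset.prod_ite_eq', Finset.mem_univ, if_true]
    ring
  simp_rw [h1]
  rw [integral_fintype_prod_eq_prod, Finset.prod_eq_single i]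
  · simpa [g] using h.integral_law_sq_le (i = k)
  · intro m _ hm
    simpa [g, hm] using h.integral_law_snd (m = k)
  · simp

/-- Observation `m` carries `a` if `m ∈ {i, l}` and `b` if `m ∈ {π i, π l}`. By independence each
contributes its own factor: `ρ` if it carries both, 0 if exactly one, 1 if neither. -/
lemma integral_pi_offDiag (h : IsPerturbation μX μY ρ a b) (π : Equiv.Perm (Fin n)) {i l : Fin n}
    (hil : i ≠ l) :
    ∫ z, (a (z i).1 * b (z (π i)).2) * (a (z l).1 * b (z (π l)).2)
      ∂(Measure.pi fun _ : Fin n => perturbLaw μX μY ρ a b)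
      = ∏ m, if m = i ∨ m = l then (if m = π i ∨ m = π l then ρ else 0)
          else (if m = π i ∨ m = π l then 0 else 1) := by
  have := h.isProbabilityMeasure
  let g : Fin n → X × Y → ℝ := fun m z =>
    (if m = i ∨ m = l then a z.1 else 1) * (if m = π i ∨ m = π l then b z.2 else 1)
  have h1 : ∀ z : Fin n → X × Y,
      (a (z i).1 * b (z (π i)).2) * (a (z l).1 * b (z (π l)).2) = ∏ m, g m (z m) := fun z => by
    simp only [g, Finset.prod_mul_distrib]
    rw [prod_ite_or hil fun m => a (z m).1,
      prod_ite_or (π.injective.ne hil) fun m => b (z m).2]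
    ring
  simp_rw [h1]
  rw [integral_fintype_prod_eq_prod]
  exact Finset.prod_congr rfl fun m _ => h.integral_law_ite _ _

lemma integral_pi_offDiag_one (h : IsPerturbation μX μY ρ a b) {i l : Fin n} (hil : i ≠ l) :
    ∫ z, (a (z i).1 * b (z i).2) * (a (z l).1 * b (z l).2)
      ∂(Measure.pi fun _ : Fin n => perturbLaw μX μY ρ a b) = ρ ^ 2 := by
  refine (h.integral_pi_offDiag (n := n) 1 hil).trans ?_
  rw [pow_two, ← prod_ite_or hil fun _ => ρ]
  refine Finset.prod_congr rfl fun m _ => ?_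
  simp only [Equiv.Perm.coe_one, id]
  by_cases hm : m = i ∨ m = l
  · exact (if_pos hm).trans ((if_pos hm).trans (if_pos hm).symm)
  · exact (if_neg hm).trans ((if_neg hm).trans (if_neg hm).symm)

/-- If `π i ∉ {i, l}`, observation `π i` carries only the centred `b` and kills the product;
otherwise all factors lie in `[0, 1]`. -/
lemma integral_pi_offDiag_le (h : IsPerturbation μX μY ρ a b) (π : Equiv.Perm (Fin n))
    {i l : Fin n} (hil : i ≠ l) :
    ∫ z, (a (z i).1 * b (z (π i)).2) * (a (z l).1 * b (z (π l)).2)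
      ∂(Measure.pi fun _ : Fin n => perturbLaw μX μY ρ a b)
      ≤ (if π i = i then 1 else 0) + (if π i = l then 1 else 0) := by
  rw [h.integral_pi_offDiag π hil]
  by_cases h1 : π i = i ∨ π i = l
  · have h2 : (1 : ℝ) ≤ (if π i = i then 1 else 0) + (if π i = l then 1 else 0) := by
      rcases h1 with h1 | h1
      · rw [if_pos h1]; split_ifs <;> norm_num
      · rw [if_pos h1]; split_ifs <;> norm_num
    refine le_trans (Finset.prod_le_one (fun m _ => ?_) fun m _ => ?_) h2
    · have := h.pos.le
      split_ifs <;> first | assumption | norm_num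
    · have := h.le_one
      split_ifs <;> first | assumption | norm_num
  · rw [Finset.prod_eq_zero (Finset.mem_univ (π i))]
    · split_ifs <;> norm_num
    · rw [if_neg h1, if_pos (Or.inl rfl)]

lemma integral_sq_bilinStat_permute (h : IsPerturbation μX μY ρ a b) (π : Equiv.Perm (Fin n)) :
    ∫ z, bilinStat a b (permute π z) ^ 2 ∂(Measure.pi fun _ : Fin n => perturbLaw μX μY ρ a b)
      = ∑ i, ∑ l, ∫ z, (a (z i).1 * b (z (π i)).2) * (a (z l).1 * b (z (π l)).2)
      ∂(Measure.pi fun _ : Fin n => perturbLaw μX μY ρ a b) := by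
  have := h.isProbabilityMeasure
  have hb : ∀ i l : Fin n, IsBddMeas fun z : Fin n → X × Y =>
      (a (z i).1 * b (z (π i)).2) * (a (z l).1 * b (z (π l)).2) :=
    fun i l => (h.bdd_term i (π i)).mul (h.bdd_term l (π l))
  simp_rw [bilinStat, permute, pow_two, Finset.sum_mul_sum]
  rw [integral_finsetSum _ fun i _ => (IsBddMeas.sum _ fun l => hb i l).integrable _]
  exact Finset.sum_congr rfl fun i _ => integral_finsetSum _ fun l _ => (hb i l).integrable _

/-- The diagonal gives `2 n`, the pairs with `π i = l` give `n`, and each fixed point of `π` gives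
at most `n`. Keeping fixed points explicit allows averaging over `π` later. -/
lemma integral_sq_bilinStat_permute_le (h : IsPerturbation μX μY ρ a b)
    (π : Equiv.Perm (Fin n)) :
    ∫ z, bilinStat a b (permute π z) ^ 2 ∂(Measure.pi fun _ : Fin n => perturbLaw μX μY ρ a b)
      ≤ 3 * n + n * ∑ i, if π i = i then (1 : ℝ) else 0 := by
  rw [h.integral_sq_bilinStat_permute]
  calc _ ≤ ∑ i : Fin n, ∑ l : Fin n, ((if i = l then (2 : ℝ) else 0)
          + ((if π i = i then 1 else 0) + (if π i = l then 1 else 0))) := by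
        refine Finset.sum_le_sum fun i _ => Finset.sum_le_sum fun l _ => ?_
        by_cases hil : i = l
        · subst hil
          rw [if_pos rfl]
          have := h.integral_pi_diag_le i (π i)
          have h3 : (0 : ℝ) ≤ (if π i = i then 1 else 0) + (if π i = i then 1 else 0) := by
            split_ifs <;> norm_num
          linarith
        · rw [if_neg hil, zero_add]
          exact h.integral_pi_offDiag_le π hil
    _ = _ := by
        simp only [Finset.sum_add_distrib, Finset.sum_ite_eq, Finset.mem_univ, if_true,
          Finset.sum_const, Finset.card_univ, Fintype.card_fin, nsmul_eq_mul, ← Finset.mul_sum]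
        ring

lemma integral_bilinStat (h : IsPerturbation μX μY ρ a b) :
    ∫ z, bilinStat a b z ∂(Measure.pi fun _ : Fin n => perturbLaw μX μY ρ a b) = n * ρ := by
  have := h.isProbabilityMeasure
  simp_rw [bilinStat]
  rw [integral_finsetSum _ fun i _ => (h.bdd_term i i).integrable _]
  have : ∀ i : Fin n, ∫ z, a (z i).1 * b (z i).2
      ∂(Measure.pi fun _ : Fin n => perturbLaw μX μY ρ a b) = ρ := fun i => by
    rw [integral_comp_eval (μ := fun _ : Fin n => perturbLaw μX μY ρ a b) (i := i)
      (f := fun w : X × Y => a w.1 * b w.2) h.bdd_mul.measurable.aestronglyMeasurable]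
    simpa using h.integral_law_ite True True
  simp [this]

/-- A variance bound: the off-diagonal terms, each `ρ²`, are absorbed by the squared mean, leaving
`2 n` from the diagonal. -/
lemma integral_sq_bilinStat_sub_le (h : IsPerturbation μX μY ρ a b) :
    ∫ z, (bilinStat a b z - n * ρ) ^ 2 ∂(Measure.pi fun _ : Fin n => perturbLaw μX μY ρ a b)
      ≤ 2 * n := by
  have := h.isProbabilityMeasure
  have hb : IsBddMeas fun z : Fin n → X × Y => bilinStat a b z := h.bdd_bilinStat 1
  have h2 : ∫ z, bilinStat a b z ^ 2 ∂(Measure.pi fun _ : Fin n => perturbLaw μX μY ρ a b)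
      ≤ 2 * n + (n * ρ) ^ 2 := by
    have := h.integral_sq_bilinStat_permute (n := n) 1
    simp only [show ∀ z : Fin n → X × Y, permute 1 z = z from fun z => rfl,
      Equiv.Perm.coe_one, id] at this
    rw [this]
    calc _ ≤ ∑ i : Fin n, ∑ l : Fin n, ((if i = l then (2 : ℝ) else 0) + ρ ^ 2) := by
          refine Finset.sum_le_sum fun i _ => Finset.sum_le_sum fun l _ => ?_
          by_cases hil : i = l
          · subst hil
            rw [if_pos rfl]
            have := h.integral_pi_diag_le i i
            nlinarith [sq_nonneg ρ]
          · rw [if_neg hil, zero_add]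
            exact (h.integral_pi_offDiag_one hil).le
      _ = _ := by
          simp only [Finset.sum_add_distrib, Finset.sum_ite_eq, Finset.mem_univ, if_true,
            Finset.sum_const, Finset.card_univ, Fintype.card_fin, nsmul_eq_mul]
          ring
  have h3 : ∀ z : Fin n → X × Y, (bilinStat a b z - n * ρ) ^ 2
      = bilinStat a b z ^ 2 + (-(2 * (n * ρ)) * bilinStat a b z + (n * ρ) ^ 2) := fun z => by ring
  simp_rw [h3]
  rw [integral_add (hb.sq.integrable _)
      ((((IsBddMeas.const _).mul hb).add (IsBddMeas.const _)).integrable _),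
    integral_add (((IsBddMeas.const _).mul hb).integrable _) (integrable_const _),
    integral_const_mul, h.integral_bilinStat]
  simp only [integral_const, probReal_univ, one_smul]
  linarith

end IsPerturbation

end

/-! ### Power of the permutation test -/

/-- For each `b` and `i`, uniformly random permutations `s b` map `i` to every `l` equally often. -/
lemma card_mul_sum_fixed {ι κ : Type*} [Fintype ι] [DecidableEq ι] [Fintype κ] [DecidableEq κ]
    (b : κ) (i : ι) :
    (Fintype.card ι : ℝ) * ∑ s : κ → Equiv.Perm ι, (if s b i = i then (1 : ℝ) else 0)
      = Fintype.card (κ → Equiv.Perm ι) := by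
  have hsymm : ∀ l : ι, ∑ s : κ → Equiv.Perm ι, (if s b i = i then (1 : ℝ) else 0)
      = ∑ s : κ → Equiv.Perm ι, (if s b i = l then (1 : ℝ) else 0) := fun l => by
    refine Fintype.sum_equiv (Equiv.mulLeft fun _ : κ => Equiv.swap i l) _ _ fun s => ?_
    have : s b i = i ↔ (Equiv.mulLeft (fun _ : κ => Equiv.swap i l) s) b i = l := by
      simp only [Equiv.coe_mulLeft, Pi.mul_apply, Equiv.Perm.mul_apply]
      rw [Equiv.swap_apply_eq_iff, Equiv.swap_apply_right]
    simp only [this]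
  calc _ = ∑ l : ι, ∑ s : κ → Equiv.Perm ι, (if s b i = l then (1 : ℝ) else 0) := by
        rw [← Finset.sum_congr rfl fun l _ => hsymm l]; simp
    _ = _ := by rw [Finset.sum_comm]; simp

/-- A uniformly random permutation has one fixed point on average. -/
lemma sum_card_fixed {ι κ : Type*} [Fintype ι] [Nonempty ι] [DecidableEq ι] [Fintype κ]
    [DecidableEq κ] (b : κ) :
    ∑ s : κ → Equiv.Perm ι, ∑ i, (if s b i = i then (1 : ℝ) else 0)
      = Fintype.card (κ → Equiv.Perm ι) := by
  have hpos : (Fintype.card ι : ℝ) ≠ 0 := by exact_mod_cast Fintype.card_ne_zero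
  refine mul_left_cancel₀ hpos ?_
  rw [Finset.sum_comm, Finset.mul_sum, Finset.sum_congr rfl fun i _ => card_mul_sum_fixed b i]
  simp

/-- Chebyshev-type bound for the indicator that `t ≤ u`. -/
lemma ite_le_sq_add_sq {t u c : ℝ} (hc : 0 < c) :
    (if t ≤ u then (1 : ℝ) else 0) ≤ 4 / c ^ 2 * ((t - c) ^ 2 + u ^ 2) := by
  split_ifs with h
  -- From `t ≤ u`, `c ≤ (c - t) + u`, so `c² ≤ 2 ((t - c)² + u²)`; the constant 4 leaves room.
  · rw [div_mul_eq_mul_div, le_div_iff₀ (by positivity)]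
    nlinarith [sq_nonneg (t - c + u), sq_nonneg (t - c - u), mul_nonneg hc.le (sub_nonneg.2 h),
      sq_nonneg (u - c / 2), sq_nonneg (u + t - c), sq_nonneg (c - 2 * u), sq_nonneg (u - t)]
  · positivity

section

variable {X Y : Type*}

/-- Markov's inequality for the permutation p-value. -/
lemma one_sub_permTest_le {n : ℕ} {α : ℝ} (hα : 0 < α) (T : (Fin n → X × Y) → ℝ) (B : ℕ)
    (z : Fin n → X × Y) :
    1 - permTest α T B z ≤ (∑ s : Fin B → Equiv.Perm (Fin n),
      (1 + ∑ b, if T z ≤ T (permute (s b) z) then (1 : ℝ) else 0)) / ((1 + (B : ℝ)) * α)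
      / (Fintype.card (Fin B → Equiv.Perm (Fin n)) : ℝ) := by
  have hcard : (0 : ℝ) < Fintype.card (Fin B → Equiv.Perm (Fin n)) := by
    exact_mod_cast Fintype.card_pos
  have hBα : 0 < (1 + (B : ℝ)) * α := by positivity
  rw [permTest_eq_sum, sub_le_iff_le_add, ← add_div, le_div_iff₀ hcard, one_mul, Finset.sum_div,
    ← Finset.sum_add_distrib]
  have hone : (Fintype.card (Fin B → Equiv.Perm (Fin n)) : ℝ)
      = ∑ _s : Fin B → Equiv.Perm (Fin n), (1 : ℝ) := by simp
  rw [hone]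
  refine Finset.sum_le_sum fun s _ => ?_
  rw [Finset.sum_boole]
  split_ifs with h
  · have : (0 : ℝ) ≤ (1 + ((Finset.univ.filter fun b => T z ≤ T (permute (s b) z)).card : ℝ))
      / ((1 + (B : ℝ)) * α) := by positivity
    linarith
  · rw [add_zero, le_div_iff₀ hBα, one_mul]
    exact (not_le.mp h).le

variable [MeasurableSpace X] [MeasurableSpace Y]

namespace IsPerturbation

variable {μX : Measure X} {μY : Measure Y} [IsProbabilityMeasure μX] [IsProbabilityMeasure μY]
  {ρ : ℝ} {a : X → ℝ} {b : Y → ℝ} {n : ℕ}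

/-- Type II error of the permutation test based on the bilinear statistic. -/
lemma one_sub_expectD_permTest_le (h : IsPerturbation μX μY ρ a b) (hn : 1 ≤ n) {α : ℝ}
    (hα : 0 < α) (B : ℕ) :
    1 - expectD μX μY (perturb ρ a b) (permTest (n := n) α (bilinStat a b) B)
      ≤ (1 + B * (24 / (n * ρ ^ 2))) / ((1 + B) * α) := by
  have hprob := h.isProbabilityMeasure
  have hρ := h.pos
  have hn0 : (0 : ℝ) < n := by exact_mod_cast hn
  have : Nonempty (Fin n) := ⟨⟨0, hn⟩⟩
  set Q := Measure.pi fun _ : Fin n => perturbLaw μX μY ρ a b with hQ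
  set N : ℝ := (Fintype.card (Fin B → Equiv.Perm (Fin n)) : ℝ) with hN
  have hNpos : 0 < N := by rw [hN]; exact_mod_cast Fintype.card_pos
  have hBα : 0 < (1 + (B : ℝ)) * α := by positivity
  have hT : IsBddMeas fun z : Fin n → X × Y => bilinStat a b z := h.bdd_bilinStat 1
  -- A bounded majorant of the indicator that the permuted statistic reaches the observed one, with
  -- `c = n ρ` the mean of the latter.
  let W : Equiv.Perm (Fin n) → (Fin n → X × Y) → ℝ := fun π z =>
    4 / (n * ρ) ^ 2 * ((bilinStat a b z + -(n * ρ)) ^ 2 + bilinStat a b (permute π z) ^ 2)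
  have hW : ∀ π, IsBddMeas (W π) := fun π => (IsBddMeas.const _).mul
    ((hT.add (IsBddMeas.const (-(n * ρ)))).sq.add (h.bdd_bilinStat π).sq)
  have hWint : ∀ π, ∫ z, W π z ∂Q
      ≤ 4 / (n * ρ) ^ 2 * (5 * n + n * ∑ i, if π i = i then (1 : ℝ) else 0) := fun π => by
    simp only [W]
    rw [integral_const_mul, integral_add ((hT.add (IsBddMeas.const (-(n * ρ)))).sq.integrable _)
      ((h.bdd_bilinStat π).sq.integrable _)]
    have h1 := h.integral_sq_bilinStat_sub_le (n := n)
    have h2 := h.integral_sq_bilinStat_permute_le π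
    simp only [sub_eq_add_neg] at h1
    refine mul_le_mul_of_nonneg_left ?_ (by positivity)
    linarith
  have hVint : ∀ s : Fin B → Equiv.Perm (Fin n),
      IsBddMeas fun z => 1 + ∑ b, W (s b) z := fun s =>
    (IsBddMeas.const 1).add (IsBddMeas.sum _ fun b => hW _)
  have hφ := (isTest_permTest α hT.measurable B).integrable Q
  -- With one fixed point on average, `W` has mean at most `4 / (n ρ)² * (5 n + n) = 24 / (n ρ²)`.
  have hsum : ∑ s : Fin B → Equiv.Perm (Fin n), ∫ z, (1 + ∑ b, W (s b) z) ∂Q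
      ≤ N * (1 + B * (24 / (n * ρ ^ 2))) := by
    calc _ ≤ ∑ s : Fin B → Equiv.Perm (Fin n), (1 + ∑ b : Fin B,
          4 / (n * ρ) ^ 2 * (5 * n + n * ∑ i, if s b i = i then (1 : ℝ) else 0)) := by
          refine Finset.sum_le_sum fun s _ => ?_
          rw [integral_add (integrable_const _)
            ((IsBddMeas.sum _ fun b => hW (s b)).integrable _),
            integral_finsetSum _ fun b _ => (hW (s b)).integrable _]
          simp only [integral_const, probReal_univ, one_smul]
          gcongr with b
          exact hWint _
      _ = N * (1 + B * (24 / (n * ρ ^ 2))) := by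
          rw [Finset.sum_add_distrib, Finset.sum_comm]
          simp_rw [← Finset.mul_sum, Finset.sum_add_distrib, ← Finset.mul_sum, sum_card_fixed]
          simp only [Finset.sum_const, Finset.card_univ, nsmul_eq_mul, ← hN, Fintype.card_fin]
          field_simp
          ring
  have hmain : ∫ z, (1 - permTest α (bilinStat a b) B z) ∂Q
      ≤ ∫ z, (∑ s : Fin B → Equiv.Perm (Fin n), (1 + ∑ b, W (s b) z)) / ((1 + (B : ℝ)) * α) / N
        ∂Q := by
    refine integral_mono ((integrable_const _).sub hφ)
      ((((IsBddMeas.sum _ hVint).integrable _).div_const _).div_const _) fun z => ?_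
    refine (one_sub_permTest_le hα (bilinStat a b) B z).trans ?_
    gcongr with s _ l _
    have := ite_le_sq_add_sq (t := bilinStat a b z) (u := bilinStat a b (permute (s l) z))
      (c := n * ρ) (by positivity)
    simpa [W, sub_eq_add_neg] using this
  rw [integral_sub (integrable_const _) hφ, integral_div, integral_div,
    integral_finsetSum _ fun s _ => (hVint s).integrable _] at hmain
  simp only [integral_const, probReal_univ, one_smul] at hmain
  refine hmain.trans ?_
  rw [div_le_iff₀ hNpos, div_mul_eq_mul_div]
  gcongr
  linarith

/-- Power of the permutation test with `n` permutations when `n ρ²` is large. -/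
lemma le_expectD_permTest (h : IsPerturbation μX μY ρ a b) (hn : 1 ≤ n) {α β : ℝ}
    (hα : 0 < α) (hβ : 0 < β) (hlarge : 48 / (α * β) / ρ ^ 2 < n) :
    1 - β ≤ expectD μX μY (perturb ρ a b) (permTest (n := n) α (bilinStat a b) n) := by
  have hρ := h.pos
  have hn0 : (0 : ℝ) < n := by exact_mod_cast hn
  have h1 := h.one_sub_expectD_permTest_le hn hα n
  have h2 : 48 < n * ρ ^ 2 * (α * β) := by
    rwa [div_div, div_lt_iff₀ (by positivity), mul_comm (α * β), ← mul_assoc] at hlarge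
  have hρ2 : ρ ^ 2 ≤ 1 := pow_le_one₀ hρ.le h.le_one
  have h3 : (48 : ℝ) < n * (α * β) :=
    h2.trans_le (by gcongr; exact mul_le_of_le_one_right hn0.le hρ2)
  -- Half of the error budget goes to the permutations; the other half covers the leading `1`,
  -- because `B = n` and `n α β > 48`.
  have h4 : 24 / (n * ρ ^ 2) ≤ α * β / 2 := by
    rw [div_le_iff₀ (by positivity)]; linarith
  have h5 : (1 + n * (24 / (n * ρ ^ 2))) / ((1 + n) * α) ≤ β := by
    rw [div_le_iff₀ (by positivity)]
    have : (n : ℝ) * (24 / (n * ρ ^ 2)) ≤ n * (α * β / 2) := by gcongr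
    nlinarith [mul_pos hα hβ]
  linarith

end IsPerturbation

end

/-! ### Second moment lower bound -/

/-- The Cauchy-Schwarz inequality for bounded functions. -/
lemma IsBddMeas.sq_integral_mul_le {Z : Type*} [MeasurableSpace Z] {g h : Z → ℝ}
    (hg : IsBddMeas g) (hh : IsBddMeas h) (μ : Measure Z) [IsFiniteMeasure μ] :
    (∫ z, g z * h z ∂μ) ^ 2 ≤ (∫ z, g z ^ 2 ∂μ) * ∫ z, h z ^ 2 ∂μ := by
  -- The quadratic `t ↦ ∫ (t g + h)²` is nonnegative, so its discriminant is at most 0.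
  have key : ∀ t : ℝ, 0 ≤ (∫ z, g z ^ 2 ∂μ) * (t * t) + (2 * ∫ z, g z * h z ∂μ) * t
      + ∫ z, h z ^ 2 ∂μ := fun t => by
    have h1 : (∫ z, g z ^ 2 ∂μ) * (t * t) + (2 * ∫ z, g z * h z ∂μ) * t + ∫ z, h z ^ 2 ∂μ
        = ∫ z, (t * g z + h z) ^ 2 ∂μ := by
      have h2 : ∀ z, (t * g z + h z) ^ 2 = (t * t) * g z ^ 2 + (2 * t) * (g z * h z) + h z ^ 2 :=
        fun z => by ring
      simp_rw [h2]
      rw [integral_add ((((IsBddMeas.const _).mul hg.sq).add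
          ((IsBddMeas.const _).mul (hg.mul hh))).integrable μ) (hh.sq.integrable μ),
        integral_add ((hg.sq.integrable μ).const_mul _) (((hg.mul hh).integrable μ).const_mul _),
        integral_const_mul, integral_const_mul]
      ring
    rw [h1]
    exact integral_nonneg fun z => sq_nonneg _
  have := discrim_le_zero key
  rw [discrim] at this
  linarith

/-- Among orthogonal perturbations of the uniform density, the test `ψ` has small power against at
least one. -/
lemma exists_integral_mul_prod_le {Z ι : Type*} [MeasurableSpace Z] [DecidableEq ι] {n : ℕ}
    (μ : Measure Z) [IsProbabilityMeasure μ] {f : ι → Z → ℝ} (hf : ∀ m, IsBddMeas (f m)) {c : ℝ}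
    (hc : 0 ≤ c) (hmean : ∀ m, ∫ z, f m z ∂μ = 1)
    (hcov : ∀ m m', ∫ z, f m z * f m' z ∂μ = 1 + if m = m' then c else 0)
    {ψ : (Fin n → Z) → ℝ} (hψ : Measurable ψ) (hψ01 : ∀ z, ψ z ∈ Set.Icc (0 : ℝ) 1) {α : ℝ}
    (hα : ∫ z, ψ z ∂(Measure.pi fun _ : Fin n => μ) ≤ α) {S : Finset ι} (hS : S.Nonempty) :
    ∃ m ∈ S, ∫ z, ψ z * ∏ i, f m (z i) ∂(Measure.pi fun _ : Fin n => μ)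
      ≤ α + √(((1 + c) ^ n - 1) * α / S.card) := by
  set P := Measure.pi fun _ : Fin n => μ with hP
  set V := (1 + c) ^ n - 1 with hV
  have hV0 : 0 ≤ V := sub_nonneg.2 (one_le_pow₀ (by linarith))
  have hψb : IsBddMeas ψ := ⟨hψ, 1, fun z => by
    rw [abs_le]; exact ⟨by linarith [(hψ01 z).1], (hψ01 z).2⟩⟩
  have hcard : (0 : ℝ) < S.card := by exact_mod_cast hS.card_pos
  let L : ι → (Fin n → Z) → ℝ := fun m z => ∏ i, f m (z i)
  have hL : ∀ m, IsBddMeas (L m) := fun m =>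
    IsBddMeas.prod _ fun i => (hf m).comp (measurable_pi_apply i)
  have hL1 : ∀ m, IsBddMeas fun z => L m z + -1 := fun m => (hL m).add (IsBddMeas.const _)
  have hintL : ∀ m, ∫ z, L m z ∂P = 1 := fun m => by
    simp only [L]
    rw [integral_fintype_prod_eq_prod (fun _ => f m)]
    simp [hmean]
  have hintLL : ∀ m m', ∫ z, (L m z + -1) * (L m' z + -1) ∂P = if m = m' then V else 0 := by
    intro m m'
    have h1 : ∀ z, (L m z + -1) * (L m' z + -1)
        = (∏ i, f m (z i) * f m' (z i)) + (-1 * L m z + (-1 * L m' z + 1)) := fun z => by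
      rw [Finset.prod_mul_distrib]; simp only [L]; ring
    have b1 := (IsBddMeas.const (-1)).mul (hL m)
    have b2 := (IsBddMeas.const (-1)).mul (hL m')
    have b3 := b2.add (IsBddMeas.const 1)
    have i3 : Integrable (fun z : Fin n → Z => ∏ i, f m (z i) * f m' (z i)) P :=
      (IsBddMeas.prod _ fun i => ((hf m).mul (hf m')).comp (measurable_pi_apply i)).integrable P
    simp_rw [h1]
    rw [integral_add i3 ((b1.add b3).integrable P),
      integral_add (b1.integrable P) (b3.integrable P),
      integral_add (b2.integrable P) (integrable_const _), integral_const_mul, integral_const_mul, hintL, hintL,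
      integral_fintype_prod_eq_prod (fun _ z => f m z * f m' z)]
    simp only [hcov, Finset.prod_const, Finset.card_univ, Fintype.card_fin, integral_const,
      probReal_univ, one_smul]
    split_ifs
    · rw [hV]; ring
    · simp
  -- As `ψ` takes values in `[0, 1]`, `ψ² ≤ ψ`; this puts the factor `α` under the root.
  have hsqψ : ∫ z, ψ z ^ 2 ∂P ≤ α := by
    refine le_trans (integral_mono (hψb.sq.integrable P) (hψb.integrable P) fun z => ?_) hα
    have := hψ01 z
    nlinarith [this.1, this.2]
  have hH : IsBddMeas fun z => ∑ m ∈ S, (L m z + -1) := IsBddMeas.sum _ hL1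
  have hsqH : ∫ z, (∑ m ∈ S, (L m z + -1)) ^ 2 ∂P = S.card * V := by
    simp_rw [pow_two, Finset.sum_mul_sum]
    rw [integral_finsetSum _ fun m _ =>
      (IsBddMeas.sum S fun m' => (hL1 m).mul (hL1 m')).integrable P]
    have : ∀ m ∈ S, ∫ z, ∑ m' ∈ S, (L m z + -1) * (L m' z + -1) ∂P = V := fun m hm => by
      rw [integral_finsetSum _ fun m' _ => ((hL1 m).mul (hL1 m')).integrable P]
      simp [hintLL, hm]
    rw [Finset.sum_congr rfl this]
    simp
  have hCS : ∫ z, ψ z * ∑ m ∈ S, (L m z + -1) ∂P ≤ √(S.card * V * α) := by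
    refine Real.le_sqrt_of_sq_le ((hψb.sq_integral_mul_le hH P).trans ?_)
    rw [hsqH, mul_comm]
    gcongr
  have hexp : ∫ z, ψ z * ∑ m ∈ S, (L m z + -1) ∂P
      = ∑ m ∈ S, (∫ z, ψ z * L m z ∂P - ∫ z, ψ z ∂P) := by
    simp_rw [Finset.mul_sum]
    rw [integral_finsetSum _ fun m _ => (hψb.mul (hL1 m)).integrable P]
    refine Finset.sum_congr rfl fun m _ => ?_
    rw [← integral_sub ((hψb.mul (hL m)).integrable P) (hψb.integrable P)]
    exact integral_congr_ae (ae_of_all _ fun z => by ring)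
  have hsum : ∑ m ∈ S, ∫ z, ψ z * L m z ∂P
      ≤ ∑ m ∈ S, (α + √(V * α / S.card)) := by
    have h1 : √(S.card * V * α) = S.card * √(V * α / S.card) := by
      rw [show (S.card : ℝ) * V * α = (S.card : ℝ) ^ 2 * (V * α / S.card) by field_simp,
        Real.sqrt_mul (by positivity), Real.sqrt_sq hcard.le]
    rw [hexp, Finset.sum_sub_distrib] at hCS
    simp only [Finset.sum_const, nsmul_eq_mul] at hCS ⊢
    have h2 : (S.card : ℝ) * ∫ z, ψ z ∂P ≤ S.card * α := by gcongr
    rw [h1] at hCS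
    linarith
  exact Finset.exists_le_of_sum_le hS hsum

/-! ### Perturbations along basis functions -/

lemma IsL2Basis.integral_mul {Z J : Type*} [MeasurableSpace Z] [DecidableEq J] {μ : Measure Z}
    {p : J → Z → ℝ} (h : IsL2Basis μ p) (j j' : J) :
    ∫ z, p j z * p j' z ∂μ = if j = j' then 1 else 0 := by
  obtain ⟨b, hb⟩ := h.exists_basis
  rw [← orthonormal_iff_ite.mp b.orthonormal j j', L2.inner_def]
  refine integral_congr_ae ?_
  filter_upwards [hb j, hb j'] with z h1 h2
  simp [h1, h2, mul_comm]

/-- If the supremum were infinite, `1 / ∞ = 0` would contradict `0 < ρ`; so the hypothesis also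
forces uniform boundedness. -/
lemma abs_mul_le_of_le_one_div_supNorm {X Y J K : Type*} {p : J → X → ℝ} {q : K → Y → ℝ}
    {ρ : ℝ} (hρ : 0 < ρ)
    (hsup : ENNReal.ofReal ρ ≤ 1 / ⨆ (j : J) (k : K), supNorm (tensor p q j k)) (j : J) (k : K)
    (x : X) (y : Y) : |ρ * (p j x * q k y)| ≤ 1 := by
  rw [ENNReal.le_div_iff_mul_le (Or.inr one_ne_zero) (Or.inr ENNReal.one_ne_top)] at hsup
  have h1 : ‖tensor p q j k (x, y)‖ₑ ≤ ⨆ (j : J) (k : K), supNorm (tensor p q j k) :=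
    (le_iSup (fun z => ‖tensor p q j k z‖ₑ) (x, y)).trans
      (le_iSup₂ (f := fun j k => supNorm (tensor p q j k)) j k)
  have h2 : ENNReal.ofReal |ρ * (p j x * q k y)| ≤ 1 := by
    rw [abs_mul, abs_of_pos hρ, ENNReal.ofReal_mul hρ.le, ← Real.norm_eq_abs, ofReal_norm]
    exact (mul_le_mul_right h1 _).trans hsup
  exact ENNReal.ofReal_le_one.mp h2

lemma isBddMeas_fst {X Y J K : Type*} [MeasurableSpace X] [Nonempty Y] {μX : Measure X}
    {p : J → X → ℝ} {q : K → Y → ℝ} {k₀ : K} {ρ : ℝ} (hp : IsL2Basis μX p) (hq₀ : ∀ y, q k₀ y = 1) (hρ : 0 < ρ)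
    (hle : ∀ j k x y, |ρ * (p j x * q k y)| ≤ 1) (j : J) : IsBddMeas (p j) := by
  refine ⟨hp.measurable j, 1 / ρ, fun x => ?_⟩
  -- Pairing with the constant function `q k₀` isolates `p j`.
  have := hle j k₀ x (Classical.arbitrary Y)
  rw [hq₀, mul_one, abs_mul, abs_of_pos hρ] at this
  rwa [le_div_iff₀ hρ, mul_comm]

lemma isBddMeas_snd {X Y J K : Type*} [MeasurableSpace Y] [Nonempty X] {μY : Measure Y}
    {p : J → X → ℝ} {q : K → Y → ℝ} {j₀ : J} {ρ : ℝ} (hq : IsL2Basis μY q) (hp₀ : ∀ x, p j₀ x = 1) (hρ : 0 < ρ)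
    (hle : ∀ j k x y, |ρ * (p j x * q k y)| ≤ 1) (k : K) : IsBddMeas (q k) := by
  refine ⟨hq.measurable k, 1 / ρ, fun y => ?_⟩
  have := hle j₀ k (Classical.arbitrary X) y
  rw [hp₀, one_mul, abs_mul, abs_of_pos hρ] at this
  rwa [le_div_iff₀ hρ, mul_comm]

section

variable {X Y : Type*} [MeasurableSpace X] [MeasurableSpace Y]

namespace IsPerturbation

variable {μX : Measure X} {μY : Measure Y} {ρ : ℝ} {a : X → ℝ} {b : Y → ℝ}

lemma margX_eq_one [IsProbabilityMeasure μY] (h : IsPerturbation μX μY ρ a b) (x : X) :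
    margX μY (perturb ρ a b) x = 1 := by
  simp only [margX, perturb]
  rw [integral_add (integrable_const _) (((h.bddY.integrable μY).const_mul _).const_mul _),
    integral_const_mul, integral_const_mul, h.meanY]
  simp

lemma margY_eq_one [IsProbabilityMeasure μX] (h : IsPerturbation μX μY ρ a b) (y : Y) :
    margY μX (perturb ρ a b) y = 1 := by
  simp only [margY, perturb]
  rw [integral_add (integrable_const _) (((h.bddX.integrable μX).mul_const _).const_mul _),
    integral_const_mul, integral_mul_const, h.meanX]
  simp

variable [IsProbabilityMeasure μX] [IsProbabilityMeasure μY]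

lemma isDensity (h : IsPerturbation μX μY ρ a b) : IsDensity μX μY (perturb ρ a b) :=
  ⟨h.bdd_perturb.measurable, h.bdd_perturb.memLp_two _, ae_of_all _ h.perturb_nonneg,
    h.integral_perturb⟩

lemma depD_eq (h : IsPerturbation μX μY ρ a b) : depD μX μY (perturb ρ a b) = ρ ^ 2 := by
  have : ∀ z : X × Y, (perturb ρ a b z - 1 * 1) ^ 2 = ρ ^ 2 * (a z.1 ^ 2 * b z.2 ^ 2) :=
    fun z => by simp only [perturb]; ring
  simp only [depD, h.margX_eq_one, h.margY_eq_one, this]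
  rw [integral_const_mul, integral_prod_mul (fun x => a x ^ 2) (fun y => b y ^ 2), h.normX,
    h.normY]
  ring

/-- For basis functions the last product is 1 or 0 by orthonormality, which makes distinct
perturbations uncorrelated under `μ`. -/
lemma integral_perturb_mul_perturb (h : IsPerturbation μX μY ρ a b) {a' : X → ℝ} {b' : Y → ℝ}
    (h' : IsPerturbation μX μY ρ a' b') :
    ∫ z, perturb ρ a b z * perturb ρ a' b' z ∂(μX.prod μY)
      = 1 + ρ ^ 2 * ((∫ x, a x * a' x ∂μX) * ∫ y, b y * b' y ∂μY) := by
  have h1 : ∀ z : X × Y, perturb ρ a b z * perturb ρ a' b' z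
      = perturb ρ a' b' z + ρ * (a z.1 * b z.2 * perturb ρ a' b' z) := fun z => by
    simp only [perturb]; ring
  simp_rw [h1]
  rw [integral_add (h'.bdd_perturb.integrable _)
    (((h.bdd_mul.mul h'.bdd_perturb).integrable _).const_mul _), integral_const_mul,
    h'.integral_perturb, h'.integral_mul_perturb h.bddX h.bddY, h.meanX]
  ring

end IsPerturbation

variable {J K : Type*} {μX : Measure X} {μY : Measure Y} [IsProbabilityMeasure μX]
  [IsProbabilityMeasure μY] {p : J → X → ℝ} {q : K → Y → ℝ} {j₀ : J} {k₀ : K} {ρ : ℝ}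

lemma IsL2Basis.integral_eq_zero {Z J : Type*} [MeasurableSpace Z] {μ : Measure Z}
    {p : J → Z → ℝ} (h : IsL2Basis μ p) {j₀ : J} (hp₀ : ∀ z, p j₀ z = 1) {j : J} (hj : j ≠ j₀) :
    ∫ z, p j z ∂μ = 0 := by
  classical
  simpa [hp₀, hj] using h.integral_mul j j₀

lemma isPerturbation_basis (hp : IsL2Basis μX p) (hq : IsL2Basis μY q) (hp₀ : ∀ x, p j₀ x = 1)
    (hq₀ : ∀ y, q k₀ y = 1) (hρ : 0 < ρ) (hle : ∀ j k x y, |ρ * (p j x * q k y)| ≤ 1) {j : J}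
    {k : K} (hj : j ≠ j₀) (hk : k ≠ k₀) : IsPerturbation μX μY ρ (p j) (q k) := by
  classical
  have : Nonempty X := nonempty_of_isProbabilityMeasure μX
  have : Nonempty Y := nonempty_of_isProbabilityMeasure μY
  refine ⟨isBddMeas_fst hp hq₀ hρ hle j, isBddMeas_snd hq hp₀ hρ hle k,
    hp.integral_eq_zero hp₀ hj, hq.integral_eq_zero hq₀ hk, ?_, ?_, hρ, ?_, hle j k⟩
  · simpa [pow_two] using hp.integral_mul j j
  · simpa [pow_two] using hq.integral_mul k k
  · have := hle j₀ k₀ (Classical.arbitrary X) (Classical.arbitrary Y)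
    rw [hp₀, hq₀, mul_one, mul_one] at this
    exact (le_abs_self _).trans this

lemma smoothS_perturb_le (hp : IsL2Basis μX p) (hq : IsL2Basis μY q) (hp₀ : ∀ x, p j₀ x = 1)
    (hq₀ : ∀ y, q k₀ y = 1) (hρ : 0 < ρ) (hle : ∀ j k x y, |ρ * (p j x * q k y)| ≤ 1)
    {θ : J → K → ℝ≥0} {r : ℝ} {m : J × K} (hm : m ∈ freqSet j₀ k₀ θ (r / ρ)) :
    smoothS μX μY p q θ (perturb ρ (p m.1) (q m.2)) ≤ ENNReal.ofReal (r ^ 2) := by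
  classical
  have : Nonempty X := nonempty_of_isProbabilityMeasure μX
  have : Nonempty Y := nonempty_of_isProbabilityMeasure μY
  obtain ⟨hj, hk, hθ⟩ := hm
  have h := isPerturbation_basis hp hq hp₀ hq₀ hρ hle hj hk
  -- Uniform marginals make the product of marginal coefficients cancel the unperturbed part of
  -- `coeff`.
  have hdiff : ∀ j k, coeff μX μY p q (perturb ρ (p m.1) (q m.2)) j k
      - coeffX μX μY p (perturb ρ (p m.1) (q m.2)) j
        * coeffY μX μY q (perturb ρ (p m.1) (q m.2)) k
      = ρ * ((if j = m.1 then 1 else 0) * if k = m.2 then 1 else 0) := fun j k => by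
    have h1 := h.integral_mul_perturb (isBddMeas_fst hp hq₀ hρ hle j)
      (isBddMeas_snd hq hp₀ hρ hle k)
    rw [hp.integral_mul, hq.integral_mul] at h1
    simp only [coeff, coeffX, coeffY, h.margX_eq_one, h.margY_eq_one, one_mul, tensor,
      mul_comm (perturb _ _ _ _)]
    rw [h1]; ring
  have hS : smoothS μX μY p q θ (perturb ρ (p m.1) (q m.2))
      = (θ m.1 m.2 : ℝ≥0∞) ^ 2 * ENNReal.ofReal (ρ ^ 2) := by
    simp only [smoothS, hdiff]
    rw [tsum_eq_single m.1 fun j hj => by simp [hj], tsum_eq_single m.2 fun k hk => by simp [hk]]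
    simp
  rw [hS, ← ENNReal.ofReal_coe_nnreal, ← ENNReal.ofReal_pow NNReal.zero_le_coe,
    ← ENNReal.ofReal_mul (by positivity), ← mul_pow]
  refine ENNReal.ofReal_le_ofReal (pow_le_pow_left₀ (by positivity) ?_ 2)
  rwa [← le_div_iff₀ hρ]

/-- Some perturbation with index in `freqSet` is detected by `ψ` with small probability only. -/
lemma exists_expectD_perturb_le (hp : IsL2Basis μX p) (hq : IsL2Basis μY q)
    (hp₀ : ∀ x, p j₀ x = 1) (hq₀ : ∀ y, q k₀ y = 1) (hρ : 0 < ρ)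
    (hle : ∀ j k x y, |ρ * (p j x * q k y)| ≤ 1) {n : ℕ} {ψ : (Fin n → X × Y) → ℝ}
    (hψ : IsTest ψ) {α : ℝ} (hα : expectD μX μY (tensor p q j₀ k₀) ψ ≤ α) {θ : J → K → ℝ≥0}
    {T : ℝ} (S : Finset (freqSet j₀ k₀ θ T)) (hS : S.Nonempty) :
    ∃ m : freqSet j₀ k₀ θ T, expectD μX μY (perturb ρ (p m.1.1) (q m.1.2)) ψ
      ≤ α + √(((1 + ρ ^ 2) ^ n - 1) * α / S.card) := by
  classical
  have hpert : ∀ m : freqSet j₀ k₀ θ T, IsPerturbation μX μY ρ (p m.1.1) (q m.1.2) :=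
    fun m => isPerturbation_basis hp hq hp₀ hq₀ hρ hle m.2.1 m.2.2.1
  have hone : tensor p q j₀ k₀ = fun _ => 1 := by
    funext z; simp [tensor, hp₀, hq₀]
  rw [hone, expectD_eq_integral_mul_prod μX μY (IsBddMeas.const 1) fun _ => zero_le_one] at hα
  simp only [Finset.prod_const_one, mul_one] at hα
  obtain ⟨m, -, hm⟩ := exists_integral_mul_prod_le (μX.prod μY)
    (f := fun m : freqSet j₀ k₀ θ T => perturb ρ (p m.1.1) (q m.1.2)) (c := ρ ^ 2)
    (fun m => (hpert m).bdd_perturb) (sq_nonneg ρ) (fun m => (hpert m).integral_perturb)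
    (fun m m' => by
      rw [(hpert m).integral_perturb_mul_perturb (hpert m'), hp.integral_mul, hq.integral_mul]
      by_cases h : m = m'
      · simp [h]
      · have : ¬ (m.1.1 = m'.1.1 ∧ m.1.2 = m'.1.2) := fun h' =>
          h (Subtype.ext (Prod.ext h'.1 h'.2))
        rw [not_and_or] at this
        rcases this with h' | h' <;> simp [h, h'])
    hψ.measurable hψ.mem_Icc hα hS
  exact ⟨m, by rwa [expectD_eq_integral_mul_prod μX μY (hpert m).bdd_perturb
    (hpert m).perturb_nonneg]⟩

/-- The lower bound of `exists_expectD_perturb_le` over the whole of `freqSet`, up to `ε`. -/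
lemma exists_ofReal_expectD_perturb_le (hp : IsL2Basis μX p) (hq : IsL2Basis μY q)
    (hp₀ : ∀ x, p j₀ x = 1) (hq₀ : ∀ y, q k₀ y = 1) (hρ : 0 < ρ)
    (hle : ∀ j k x y, |ρ * (p j x * q k y)| ≤ 1) {n : ℕ} {ψ : (Fin n → X × Y) → ℝ}
    (hψ : IsTest ψ) {α : ℝ} (hα0 : 0 ≤ α) (hα : expectD μX μY (tensor p q j₀ k₀) ψ ≤ α)
    {θ : J → K → ℝ≥0} {T : ℝ} (hne : (freqSet j₀ k₀ θ T).Nonempty) {ε : ℝ} (hε : 0 < ε) :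
    ∃ m : freqSet j₀ k₀ θ T, ENNReal.ofReal (expectD μX μY (perturb ρ (p m.1.1) (q m.1.2)) ψ)
      ≤ ENNReal.ofReal (α + ε) + (ENNReal.ofReal (((1 + ρ ^ 2) ^ n - 1) * α) /
          ((freqSet j₀ k₀ θ T).encard : ℝ≥0∞)) ^ (1 / 2 : ℝ) := by
  set V := ((1 + ρ ^ 2) ^ n - 1) * α with hV
  have hV0 : 0 ≤ V := mul_nonneg (sub_nonneg.2 (one_le_pow₀ (by nlinarith [sq_nonneg ρ]))) hα0
  rcases finite_or_infinite (freqSet j₀ k₀ θ T) with hfin | hinf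
  · have := Fintype.ofFinite (freqSet j₀ k₀ θ T)
    have : Nonempty (freqSet j₀ k₀ θ T) := hne.to_subtype
    obtain ⟨m, hm⟩ := exists_expectD_perturb_le hp hq hp₀ hq₀ hρ hle hψ hα
      (Finset.univ : Finset (freqSet j₀ k₀ θ T)) Finset.univ_nonempty
    refine ⟨m, ?_⟩
    have hcard : (0 : ℝ) < Fintype.card (freqSet j₀ k₀ θ T) := by exact_mod_cast Fintype.card_pos
    have henc : ((freqSet j₀ k₀ θ T).encard : ℝ≥0∞)
        = ENNReal.ofReal (Fintype.card (freqSet j₀ k₀ θ T)) := by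
      rw [Set.encard, ENat.card_eq_coe_fintype_card, ENat.toENNReal_coe, ENNReal.ofReal_natCast]
    rw [henc, ← ENNReal.ofReal_div_of_pos hcard,
      ENNReal.ofReal_rpow_of_nonneg (by positivity) (by norm_num), ← Real.sqrt_eq_rpow,
      ← ENNReal.ofReal_add (by positivity) (Real.sqrt_nonneg _)]
    refine ENNReal.ofReal_le_ofReal (hm.trans ?_)
    rw [Finset.card_univ]
    linarith
  -- With more than `V / ε²` indices the root is at most `ε`; the term with infinite cardinality is
  -- not needed.
  · obtain ⟨N, hN⟩ := exists_nat_gt (V / ε ^ 2)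
    obtain ⟨S, hS⟩ := Infinite.exists_subset_card_eq (freqSet j₀ k₀ θ T) (N + 1)
    obtain ⟨m, hm⟩ := exists_expectD_perturb_le hp hq hp₀ hq₀ hρ hle hψ hα S
      (Finset.card_pos.mp (by omega))
    refine ⟨m, le_add_right (ENNReal.ofReal_le_ofReal (hm.trans ?_))⟩
    gcongr
    rw [hS, ← hV, Real.sqrt_le_left hε.le, div_le_iff₀ (by positivity)]
    rw [div_lt_iff₀ (by positivity)] at hN
    push_cast
    nlinarith [sq_nonneg ε]

end

end IndepTest

theorem theorem1 :
    ∃ C : ℝ → ℝ → ℝ,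
      (∀ α β : ℝ, 0 < α → 0 < β → β < 1 - α → 0 < C α β) ∧
      ∀ (X Y J K : Type*) [MeasurableSpace X] [MeasurableSpace Y] [Countable J] [Countable K]
        (μX : Measure X) (μY : Measure Y) [IsProbabilityMeasure μX] [IsProbabilityMeasure μY]
        (p : J → X → ℝ) (q : K → Y → ℝ) (_ : IsL2Basis μX p) (_ : IsL2Basis μY q)
        (j₀ : J) (k₀ : K) (_ : ∀ x, p j₀ x = 1) (_ : ∀ y, q k₀ y = 1)
        (n : ℕ) (_ : 1 ≤ n) (α : ℝ) (_ : 0 ≤ α) (_ : α ≤ 1)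
        (ψ : (Fin n → X × Y) → ℝ) (_ : IsTest ψ)
        (_ : expectD μX μY (tensor p q j₀ k₀) ψ ≤ α)
        (θ : J → K → ℝ≥0) (ρ r : ℝ) (_ : 0 < ρ)
        (_ : ENNReal.ofReal ρ ≤ 1 / ⨆ (j : J) (k : K), supNorm (tensor p q j k))
        (_ : (freqSet j₀ k₀ θ (r / ρ)).Nonempty),
        (∀ ε : ℝ, 0 < ε →
          ∃ f : X × Y → ℝ, IsDensity μX μY f ∧
            smoothS μX μY p q θ f ≤ ENNReal.ofReal (r ^ 2) ∧
            depD μX μY f = ρ ^ 2 ∧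
            ENNReal.ofReal (expectD μX μY f ψ) ≤
              ENNReal.ofReal (α + ε) +
                (ENNReal.ofReal (((1 + ρ ^ 2) ^ n - 1) * α) /
                  ((freqSet j₀ k₀ θ (r / ρ)).encard : ℝ≥0∞)) ^ (1 / 2 : ℝ) ∧
            (0 < α →
              ∃ φ : (Fin n → X × Y) → ℝ, IsPermutationTest α φ ∧ IsValidTest α φ ∧
                ∀ β : ℝ, 0 < β → β < 1 - α → C α β / ρ ^ 2 < (n : ℝ) →
                  1 - β ≤ expectD μX μY f φ)) ∧
        ((freqSet j₀ k₀ θ (r / ρ)).Infinite →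
          ¬ ∃ δ : ℝ, 0 < δ ∧ ∀ f : X × Y → ℝ, IsDensity μX μY f →
            smoothS μX μY p q θ f ≤ ENNReal.ofReal (r ^ 2) → ρ ^ 2 ≤ depD μX μY f →
              α + δ ≤ expectD μX μY f ψ) := by
  -- The constant comes from `le_expectD_permTest`, where the number of permutations is `n`.
  refine ⟨fun α β => 48 / (α * β), fun α β hα hβ _ => by positivity, ?_⟩
  intro X Y J K _ _ _ _ μX μY _ _ p q hp hq j₀ k₀ hp₀ hq₀ n hn α hα0 _ ψ hψ hψα θ ρ r hρ hsup hne
  have hle := abs_mul_le_of_le_one_div_supNorm hρ hsup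
  refine ⟨fun ε hε => ?_, fun hinf => ?_⟩
  · obtain ⟨⟨m, hmem⟩, hm⟩ :=
      exists_ofReal_expectD_perturb_le hp hq hp₀ hq₀ hρ hle hψ hα0 hψα hne hε
    have h := isPerturbation_basis hp hq hp₀ hq₀ hρ hle hmem.1 hmem.2.1
    have hT := (h.bdd_bilinStat (n := n) 1).measurable
    exact ⟨perturb ρ (p m.1) (q m.2), h.isDensity,
      smoothS_perturb_le hp hq hp₀ hq₀ hρ hle hmem, h.depD_eq, hm, fun hα =>
      ⟨permTest α (bilinStat (p m.1) (q m.2)) n, ⟨_, hT, n, hn, rfl⟩,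
        isValidTest_permTest hα0 hT n, fun β hβ _ hlarge =>
          h.le_expectD_permTest hn hα hβ hlarge⟩⟩
  · rintro ⟨δ, hδ, hall⟩
    obtain ⟨⟨m, hmem⟩, hm⟩ :=
      -- With `ε = δ / 2`, infinite cardinality makes the last term 0, and power at most `α + δ / 2`
      -- contradicts `α + δ`.
      exists_ofReal_expectD_perturb_le hp hq hp₀ hq₀ hρ hle hψ hα0 hψα hne (half_pos hδ)
    have h := isPerturbation_basis hp hq hp₀ hq₀ hρ hle hmem.1 hmem.2.1
    have hlow := hall _ h.isDensity (smoothS_perturb_le hp hq hp₀ hq₀ hρ hle hmem) h.depD_eq.ge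
    rw [hinf.encard_eq, ENat.toENNReal_top, ENNReal.div_top,
      ENNReal.zero_rpow_of_pos (by norm_num), add_zero,
      ENNReal.ofReal_le_ofReal_iff (by positivity)] at hm
    linarith
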